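/- Throughout, graphs are finite, simple and undirected, paths have at least one vertex, the order of a path is its number of vertices, and $\log$ is the binary logarithm. The cliquewidth of a graph is the minimum number of labels with which it can be built using the following operations on vertex-labelled graphs: creating a single vertex with a given label; taking a disjoint union; for two distinct labels $i$ and $j$, adding all edges between vertices labelled $i$ and vertices labelled $j$; replacing label $i$ by label $j$ everywhere. Let $k,s,n\ge 1$ be integers, and let $G$ be a graph of cliquewidth less than $k$ that has no (not necessarily induced) subgraph isomorphic to $K_{s,s}$. If $G$ has a path of order $n$, then $G$ has an induced path of order at least $$\frac14\,(\log n)^{\frac{1}{3(k-1)(s-1)}}.$$ (In the degenerate case $(k-1)(s-1)=0$, where the exponent is undefined, it is read as $0$, with $0^0=1$; the bound is then $\frac14$.) -/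

import Mathlib

/-- Clique-width expressions with labels `0, …, k - 1`: the creation of a single labelled vertex,
disjoint union, the insertion of all edges between the vertices labelled `i` and those labelled `j`
(for distinct labels), and the replacement of label `i` by label `j`. -/
inductive CWExpr (k : ℕ) : Type
  | vertex (i : Fin k) : CWExpr k
  | union (a b : CWExpr k) : CWExpr k
  | join (i j : Fin k) (hij : i ≠ j) (a : CWExpr k) : CWExpr k
  | relabel (i j : Fin k) (a : CWExpr k) : CWExpr k

namespace CWExpr

/-- The vertex set of the labelled graph denoted by an expression. -/
def Vert {k : ℕ} : CWExpr k → Type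
  | vertex _ => Unit
  | union a b => a.Vert ⊕ b.Vert
  | join _ _ _ a => a.Vert
  | relabel _ _ a => a.Vert

/-- The labelling of the labelled graph denoted by an expression. -/
def label {k : ℕ} : (e : CWExpr k) → e.Vert → Fin k
  | vertex i => fun _ => i
  | union a b => Sum.elim a.label b.label
  | join _ _ _ a => a.label
  | relabel i j a => fun v => if a.label v = i then j else a.label v

/-- The graph denoted by an expression, labels being forgotten. -/
def graph {k : ℕ} : (e : CWExpr k) → SimpleGraph e.Vert
  | vertex _ => ⊥
  | union a b => SimpleGraph.sum a.graph b.graph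
  | join i j _ a => a.graph ⊔ SimpleGraph.fromRel (fun u v => a.label u = i ∧ a.label v = j)
  | relabel _ _ a => a.graph

end CWExpr

namespace SimpleGraph

/-- `G` can be built with `k` labels: up to isomorphism it is the graph denoted by a clique-width
expression over `k` labels. The graph without vertices needs no label. -/
def HasCliqueWidthLE {V : Type*} (G : SimpleGraph V) (k : ℕ) : Prop :=
  IsEmpty V ∨ ∃ e : CWExpr k, Nonempty (e.graph ≃g G)

/-- The cliquewidth of `G`: the least number of labels with which `G` can be built
(infinite if there is none, which happens for infinite graphs only). -/
noncomputable def cliqueWidth {V : Type*} (G : SimpleGraph V) : ℕ∞ :=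
  ⨅ (k : ℕ) (_ : G.HasCliqueWidthLE k), (k : ℕ∞)

end SimpleGraph

/-! The proof goes through tree decompositions with bags of size at most `K = 3 (k - 1) (s - 1)`.
Process a clique-width expression from the bottom up. At each subexpression the bag holds the small
label classes and the outside neighbours of the large ones; excluding `K_{s,s}` leaves fewer than
`s` vertices per label, and merging two subexpressions needs three such bags at once
(`treeDec_labelBag_union`). In such a decomposition, a path of order `2 ^ m ^ K` has at least `m ^
K` vertices in the bags of a single branch (`TreeDec.exists_branchRep`). Along that branch vertices
become intervals, at most `K` over any point. Take an induced path, inside the given path, from the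
leftmost interval to the rightmost. Either it has `m` vertices, or deleting it breaks the path into
at most `m` pieces, one of which keeps enough intervals while the thickness falls by one
(`exists_pathGraph_isIndContained_of_intervals`). -/

/-- Deleting the `q`-entries leaves at most one more block than there are deletions. The `+ 1`s pay
for deleted entries that satisfy `p` and make the bound multiplicative. -/
theorem List.exists_infix_forall_not {α : Type*} (p q : α → Bool) (L : List α) :
    ∃ Q : List α, Q <:+: L ∧ (∀ x ∈ Q, q x = false) ∧
      L.countP p + 1 ≤ (L.countP q + 1) * (Q.countP p + 1) := by
  induction h : L.length using Nat.strong_induction_on generalizing L with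
  | _ n ih =>
    subst h
    set A := L.takeWhile (fun x => !q x) with hA
    have hAq : ∀ x ∈ A, q x = false := fun x hx => by
      simpa using List.mem_takeWhile_imp hx
    have hL : A ++ L.dropWhile (fun x => !q x) = L := List.takeWhile_append_dropWhile
    rcases hr : L.dropWhile (fun x => !q x) with _ | ⟨x, L'⟩
    · rw [hr, List.append_nil] at hL
      refine ⟨L, List.infix_rfl, hL ▸ hAq, ?_⟩
      exact Nat.le_mul_of_pos_left _ (Nat.succ_pos _)
    · have hx : q x = true := by
        have hne : L.dropWhile (fun x => !q x) ≠ [] := by rw [hr]; exact List.cons_ne_nil _ _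
        have := List.head_dropWhile_not _ hne
        simpa [hr] using this
      rw [hr] at hL
      obtain ⟨Q, hQ, hQq, hQc⟩ := ih L'.length (by rw [← hL]; simp; omega) L' rfl
      have hAL : A <:+: L := ⟨[], x :: L', by simpa using hL⟩
      have hQL : Q <:+: L := hQ.trans ⟨A ++ [x], [], by simpa using hL⟩
      have hc1 : L.countP p ≤ A.countP p + 1 + L'.countP p := by
        rw [← hL, List.countP_append, List.countP_cons]; split <;> omega
      have hc2 : L'.countP q + 1 ≤ L.countP q := by
        rw [← hL, List.countP_append, List.countP_cons, if_pos hx]; omega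
      rcases le_total (A.countP p) (Q.countP p) with hle | hle
      · refine ⟨Q, hQL, hQq, ?_⟩
        have : (L'.countP q + 2) * (Q.countP p + 1) ≤ (L.countP q + 1) * (Q.countP p + 1) :=
          Nat.mul_le_mul_right _ (by omega)
        nlinarith
      · refine ⟨A, hAL, hAq, ?_⟩
        have : (L'.countP q + 2) * (A.countP p + 1) ≤ (L.countP q + 1) * (A.countP p + 1) :=
          Nat.mul_le_mul_right _ (by omega)
        have : (L'.countP q + 1) * (Q.countP p + 1) ≤ (L'.countP q + 1) * (A.countP p + 1) :=
          Nat.mul_le_mul_left _ (by omega)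
        nlinarith

namespace SimpleGraph

variable {V : Type*} {G : SimpleGraph V}

/-! ### Induced paths from shortest walks -/

/-- A chord would be a shortcut, giving a walk shorter than the distance. -/
theorem Walk.adj_getVert_iff_of_length_eq_dist {a z : V} (p : G.Walk a z)
    (hp : p.length = G.dist a z) {i j : ℕ} (hij : i < j) (hj : j ≤ p.length) :
    G.Adj (p.getVert i) (p.getVert j) ↔ i + 1 = j := by
  constructor
  · intro h
    have := dist_le (((p.take i).concat h).append (p.drop j))
    simp [Walk.length_append, Walk.take_length, Walk.drop_length] at this
    omega
  · rintro rfl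
    exact p.adj_getVert_succ (by omega)

theorem Walk.getVert_injOn_of_length_eq_dist {a z : V} (p : G.Walk a z)
    (hp : p.length = G.dist a z) {i j : ℕ} (hij : i < j) (hj : j ≤ p.length) :
    p.getVert i ≠ p.getVert j := by
  intro h
  have := dist_le ((p.take i).append ((p.drop j).copy h.symm rfl))
  simp [Walk.length_append, Walk.take_length, Walk.drop_length] at this
  omega

theorem Walk.pathGraph_isIndContained_of_length_eq_dist {a z : V} (p : G.Walk a z)
    (hp : p.length = G.dist a z) : (pathGraph (p.length + 1)).IsIndContained G := by
  have hinj : Function.Injective fun i : Fin (p.length + 1) => p.getVert i := by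
    intro i j h
    rcases lt_trichotomy i j with hij | hij | hij
    · exact absurd h (p.getVert_injOn_of_length_eq_dist hp hij (by omega))
    · exact hij
    · exact absurd h.symm (p.getVert_injOn_of_length_eq_dist hp hij (by omega))
  refine ⟨⟨⟨_, hinj⟩, ?_⟩⟩
  · intro i j
    change G.Adj (p.getVert i) (p.getVert j) ↔ _
    rw [pathGraph_adj]
    rcases lt_trichotomy i j with hij | rfl | hij
    · rw [p.adj_getVert_iff_of_length_eq_dist hp hij (by omega)]
      have : (i : ℕ) < j := hij
      omega
    · simp
    · rw [G.adj_comm, p.adj_getVert_iff_of_length_eq_dist hp hij (by omega)]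
      have : (j : ℕ) < i := hij
      omega

theorem reachable_induce_of_isChain {P : List V} (hP : P.IsChain G.Adj) :
    ∀ a z : {v | v ∈ P}, (G.induce {v | v ∈ P}).Reachable a z := by
  -- `S` is kept apart from the list, so that the list can shrink while the induced graph stays
  -- fixed.
  have key : ∀ (S : Set V) (L : List V) (x : V), (x :: L).IsChain G.Adj →
      (∀ v ∈ x :: L, v ∈ S) → ∀ (hx : x ∈ S) (y : V) (hy : y ∈ S), y ∈ x :: L →
        (G.induce S).Reachable ⟨x, hx⟩ ⟨y, hy⟩ := by
    intro S L
    induction L with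
    | nil =>
      intro x _ _ hx y hy hyx
      obtain rfl : y = x := by simpa using hyx
      exact Reachable.rfl
    | cons w L ih =>
      intro x hc hS hx y hy hyx
      rcases List.mem_cons.1 hyx with rfl | hyw
      · exact Reachable.rfl
      · rw [List.isChain_cons_cons] at hc
        have hw : w ∈ S := hS w (by simp)
        have h1 : (G.induce S).Adj ⟨x, hx⟩ ⟨w, hw⟩ := hc.1
        exact h1.reachable.trans
          (ih w hc.2 (fun v hv => hS v (List.mem_cons_of_mem _ hv)) hw y hy hyw)
  intro a z
  rcases P with _ | ⟨x, L⟩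
  · exact absurd a.2 (by simp)
  · have hx : x ∈ {v | v ∈ x :: L} := by simp
    have h := key {v | v ∈ x :: L} L x hP (fun v hv => hv) hx
    exact (h a a.2 a.2).symm.trans (h z z.2 z.2)

/-- Two vertices of a path are joined by an induced path inside the vertex set of that path. -/
theorem exists_finset_pathGraph_isIndContained [DecidableEq V] {P : List V}
    (hP : P.IsChain G.Adj) {a z : V} (ha : a ∈ P) (hz : z ∈ P) :
    ∃ Q : Finset V, (∀ v ∈ Q, v ∈ P) ∧ a ∈ Q ∧ (pathGraph Q.card).IsIndContained G ∧
      ∀ S : V → Prop, S a → (∀ u ∈ Q, ∀ w ∈ Q, S u → G.Adj u w → S w) → S z := by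
  obtain ⟨p, hp⟩ := (reachable_induce_of_isChain hP ⟨a, ha⟩ ⟨z, hz⟩).exists_walk_length_eq_dist
  have hpath : p.IsPath := p.isPath_of_length_eq_dist hp
  refine ⟨(p.support.map Subtype.val).toFinset, ?_, ?_, ?_, ?_⟩
  · intro v hv
    simp only [List.mem_toFinset, List.mem_map] at hv
    obtain ⟨w, -, rfl⟩ := hv
    exact w.2
  · simp only [List.mem_toFinset, List.mem_map]
    exact ⟨_, p.start_mem_support, rfl⟩
  · rw [List.toFinset_card_of_nodup (hpath.support_nodup.map Subtype.val_injective),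
      List.length_map, Walk.length_support]
    exact (p.pathGraph_isIndContained_of_length_eq_dist hp).trans
      ⟨Embedding.induce _⟩
  -- Connectedness of `Q` as an induction principle along the walk from `a` to `z`.
  · intro S
    clear hp hpath
    have : ∀ (x y : {v | v ∈ P}) (p : (G.induce {v | v ∈ P}).Walk x y), S x →
      (∀ u ∈ (p.support.map Subtype.val).toFinset, ∀ w ∈ (p.support.map Subtype.val).toFinset,
        S u → G.Adj u w → S w) → S y := by
      intro x y p
      induction p with
      | nil => exact fun h _ => h
      | @cons x w y h p ih =>
        intro hx hS
        refine ih (hS x (by simp) w ?_ hx h) fun u hu w hw => hS u ?_ w ?_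
        · simp only [List.mem_toFinset, List.mem_map]
          exact ⟨w, by simp, rfl⟩
        · simp only [Walk.support_cons, List.map_cons, List.toFinset_cons]
          exact Finset.mem_insert_of_mem hu
        · simp only [Walk.support_cons, List.map_cons, List.toFinset_cons]
          exact Finset.mem_insert_of_mem hw
    exact this _ _ p

/-! ### Paths in graphs with an interval representation -/

/-- A path in a graph with an interval representation of thickness `k` yields an induced path. The
vertices whose interval is a single point do not count for the thickness. -/
theorem exists_pathGraph_isIndContained_of_intervals (l r : V → ℕ) {m : ℕ} (hm : 1 ≤ m) (k : ℕ) :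
    ∀ P : List V, P.IsChain G.Adj → P.Nodup → (∀ v ∈ P, l v ≤ r v) →
      (∀ u ∈ P, ∀ v ∈ P, G.Adj u v → l u ≤ r v) →
      (∀ (b : ℕ) (S : Finset V), (∀ v ∈ S, v ∈ P ∧ l v ≤ b ∧ b < r v) → S.card ≤ k) →
      m ^ k ≤ P.countP (fun v => l v < r v) →
      ∃ m', m ≤ m' ∧ (pathGraph m').IsIndContained G := by
  classical
  induction k with
  | zero =>
    intro P _ _ _ _ hk hc
    obtain ⟨v, hv, hlr⟩ := List.countP_pos_iff.1 (lt_of_lt_of_le Nat.zero_lt_one hc)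
    have := hk (l v) {v} (by simpa [hv] using hlr)
    simp at this
  | succ k ih =>
    intro P hP hnd hlr hadj hk hc
    have hne : P.toFinset.Nonempty := by
      rw [List.toFinset_nonempty_iff]
      rintro rfl
      have := Nat.pow_pos (n := k + 1) hm
      simp at hc
      omega
    obtain ⟨a, ha, hamin⟩ := P.toFinset.exists_min_image l hne
    obtain ⟨z, hz, hzmax⟩ := P.toFinset.exists_max_image r hne
    simp only [List.mem_toFinset] at ha hz hamin hzmax
    obtain ⟨Q, hQP, haQ0, hQind, hQS⟩ := exists_finset_pathGraph_isIndContained hP ha hz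
    by_cases hQm : m ≤ Q.card
    · exact ⟨_, hQm, hQind⟩
    obtain ⟨P', hP'P, hP'Q, hcount⟩ :=
      P.exists_infix_forall_not (fun v => l v < r v) (fun v => v ∈ Q)
    simp only [decide_eq_false_iff_not] at hP'Q
    have hsub : ∀ v ∈ P', v ∈ P := fun v hv => hP'P.subset hv
    have hPQ : P.countP (fun v => v ∈ Q) ≤ Q.card := by
      rw [List.countP_eq_length_filter,
        ← List.toFinset_card_of_nodup (hnd.filter _)]
      exact Finset.card_le_card fun v hv => by simpa using (List.mem_filter.1 (List.mem_toFinset.1 hv)).2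
    refine ih P' (hP.infix hP'P) (hnd.sublist hP'P.sublist) (fun v hv => hlr v (hsub v hv))
      (fun u hu v hv => hadj u (hsub u hu) v (hsub v hv)) ?_ ?_
    · intro b S hS
      rcases S.eq_empty_or_nonempty with rfl | ⟨v, hv⟩
      · simp
      -- `Q` runs from the least left end to the greatest right end, so it must cross `b`: otherwise
      -- `r ≤ b` would spread from `a` along `Q` to `z`. The crossing vertex is missing from `P'`,
      -- which lowers the thickness.
      have hhit : ∃ q ∈ Q, l q ≤ b ∧ b < r q := by
        by_contra! hcon
        have hlo : l a ≤ b := (hamin v (hsub v (hS v hv).1)).trans (hS v hv).2.1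
        have hhi : b < r z := (hS v hv).2.2.trans_le (hzmax v (hsub v (hS v hv).1))
        have haQ : r a ≤ b := by
          exact hcon a haQ0 hlo
        have := hQS (fun v => r v ≤ b) haQ fun u hu w hw hur huw =>
          hcon w hw ((hadj w (hQP w hw) u (hQP u hu) huw.symm).trans hur)
        omega
      obtain ⟨q, hq, hqb⟩ := hhit
      have hqS : q ∉ S := fun h => hP'Q q (hS q h).1 hq
      have := hk b (insert q S) (by
        intro v hv
        rcases Finset.mem_insert.1 hv with rfl | hv
        · exact ⟨hQP _ hq, hqb⟩
        · exact ⟨hsub v (hS v hv).1, (hS v hv).2⟩)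
      rw [Finset.card_insert_of_notMem hqS] at this
      omega
    -- At most `m - 1` deletions, with fewer than `m ^ k` proper intervals left in `P'`, would leave
    -- `P` with fewer than `m ^ (k + 1)`.
    · by_contra! hlt
      have h1 : (P.countP (fun v => v ∈ Q) + 1) * (P'.countP (fun v => l v < r v) + 1)
          ≤ m * m ^ k := Nat.mul_le_mul (by omega) (by omega)
      rw [pow_succ'] at hc
      omega

/-! ### Tree decompositions and their branches -/

/-- `G.TreeDec K X Y`: the vertices of `X ∪ Y` carry a rooted tree decomposition of the graph
induced on them, with bags of size at most `K`; the root bag is contained in `X` and `Y` consists of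
the vertices that occur below the root only. -/
inductive TreeDec [DecidableEq V] (G : SimpleGraph V) (K : ℕ) : Finset V → Finset V → Prop
  | leaf (X : Finset V) : X.card ≤ K → TreeDec G K X ∅
  | introduce (X B Y : Finset V) : TreeDec G K X Y → X ⊆ B → B.card ≤ K → Disjoint B Y →
      (∀ y ∈ Y, ∀ b ∈ B, b ∉ X → ¬ G.Adj y b) → TreeDec G K B Y
  | forget (B X Y : Finset V) : TreeDec G K B Y → X ⊆ B → TreeDec G K X (Y ∪ (B \ X))
  | join (X Y₁ Y₂ : Finset V) : TreeDec G K X Y₁ → TreeDec G K X Y₂ →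
      (∀ y ∈ Y₁, ∀ z ∈ Y₂, ¬ G.Adj y z) → TreeDec G K X (Y₁ ∪ Y₂)

/-- An interval representation along a branch of a tree decomposition `G.TreeDec K X Y`. Vertices
that do not occur in the bags of the branch are represented by single points. -/
structure BranchRep [DecidableEq V] (G : SimpleGraph V) (K : ℕ) (X Y : Finset V) (l r : V → ℕ) :
    Prop where
  le : ∀ v ∈ X ∪ Y, l v ≤ r v
  meet : ∀ u ∈ X ∪ Y, ∀ v ∈ X ∪ Y, G.Adj u v → l u ≤ r v
  card : ∀ (b : ℕ) (S : Finset V), (∀ v ∈ S, v ∈ X ∪ Y ∧ l v ≤ b ∧ b < r v) → S.card ≤ K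
  left : ∀ x ∈ X, l x = 0
  right : ∀ x ∈ X, 1 ≤ r x
  below : ∀ y ∈ Y, 1 ≤ l y

theorem TreeDec.disjoint [DecidableEq V] {K : ℕ} {X Y : Finset V} (h : G.TreeDec K X Y) :
    Disjoint X Y := by
  induction h with
  | leaf => simp
  | introduce => assumption
  | forget B X Y _ hX ih =>
    exact Finset.disjoint_union_right.2 ⟨ih.mono_left hX, Finset.disjoint_sdiff⟩
  | join X Y₁ Y₂ _ _ _ ih₁ ih₂ => exact Finset.disjoint_union_right.2 ⟨ih₁, ih₂⟩

theorem TreeDec.card_le [DecidableEq V] {K : ℕ} {X Y : Finset V} (h : G.TreeDec K X Y) :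
    X.card ≤ K := by
  induction h with
  | leaf => assumption
  | introduce => assumption
  | forget B X Y _ hX ih => exact (Finset.card_le_card hX).trans ih
  | join X Y₁ Y₂ _ _ _ ih₁ ih₂ => exact ih₁

/-- The new bag takes position `0` and the rest shifts right by one. Vertices of `X` extend back to
`0`; new ones live on `[0, 1)`, as they have no neighbours in `Y`. -/
theorem BranchRep.introduce [DecidableEq V] {K : ℕ} {X B Y : Finset V} {l r : V → ℕ}
    (h : G.BranchRep K X Y l r) (hXB : X ⊆ B) (hB : B.card ≤ K) (hBY : Disjoint B Y)
    (hadj : ∀ y ∈ Y, ∀ b ∈ B, b ∉ X → ¬ G.Adj y b) :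
    G.BranchRep K B Y (fun v => if v ∈ B then 0 else l v + 1)
      (fun v => if v ∈ B \ X then 1 else r v + 1) := by
  have hY : ∀ y ∈ Y, y ∉ B := fun y hy hyB => Finset.disjoint_left.1 hBY hyB hy
  refine ⟨?_, ?_, ?_, ?_, ?_, ?_⟩
  · intro v hv
    have := h.le v
    simp only [Finset.mem_union, Finset.mem_sdiff] at *
    grind
  · intro u hu v hv huv
    have h2 := hadj u
    have h3 := fun hu => h.meet u hu v
    simp only [Finset.mem_union, Finset.mem_sdiff] at *
    grind
  · intro b S hS
    rcases b with _ | b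
    · refine (Finset.card_le_card fun v hv => ?_).trans hB
      have := hS v hv
      grind
    · refine h.card b S fun v hv => ?_
      have := hS v hv
      have := h.left v
      simp only [Finset.mem_union, Finset.mem_sdiff] at *
      grind
  · intro x hx
    simp [hx]
  · intro x hx
    grind
  · intro y hy
    simp [hY y hy]

/-- Again everything shifts, but forgotten vertices now start at `1`. Their right ends are at least
`2`, so they keep proper intervals and are counted on the branch. -/
theorem BranchRep.forget [DecidableEq V] {K : ℕ} {X B Y : Finset V} {l r : V → ℕ}
    (h : G.BranchRep K B Y l r) (hXB : X ⊆ B) (hB : B.card ≤ K) (hBY : Disjoint B Y) :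
    G.BranchRep K X (Y ∪ (B \ X)) (fun v => if v ∈ X then 0 else l v + 1) (fun v => r v + 1) := by
  refine ⟨?_, ?_, ?_, ?_, ?_, ?_⟩
  · intro v hv
    have := h.le v
    simp only [Finset.mem_union, Finset.mem_sdiff] at *
    grind
  · intro u hu v hv huv
    have h3 := fun hu => h.meet u hu v
    simp only [Finset.mem_union, Finset.mem_sdiff] at *
    grind
  · intro b S hS
    rcases b with _ | b
    · refine (Finset.card_le_card fun v hv => ?_).trans ((Finset.card_le_card hXB).trans hB)
      have := hS v hv
      grind
    · refine h.card b S fun v hv => ?_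
      have := hS v hv
      have := h.left v
      simp only [Finset.mem_union, Finset.mem_sdiff] at *
      grind
  · intro x hx
    simp [hx]
  · intro x hx
    simp
  · intro y hy
    have : y ∉ X := fun hyX => by
      have := Finset.disjoint_left.1 hBY (hXB hyX)
      grind
    simp [this]

/-- The branch continues into `Y`. Vertices of `Z` shrink to the point `1`, which the interval of
every vertex of `X` reaches thanks to `right`. -/
theorem BranchRep.join [DecidableEq V] {K : ℕ} {X Y Z : Finset V} {l r : V → ℕ}
    (h : G.BranchRep K X Y l r) (hXZ : Disjoint X Z) (hadj : ∀ y ∈ Y, ∀ z ∈ Z, ¬ G.Adj y z) :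
    G.BranchRep K X (Y ∪ Z) (fun v => if v ∈ X ∪ Y then l v else 1)
      (fun v => if v ∈ X ∪ Y then r v else 1) := by
  have hZ : ∀ z ∈ Z, z ∉ X := fun z hz hzX => Finset.disjoint_left.1 hXZ hzX hz
  refine ⟨?_, ?_, ?_, ?_, ?_, ?_⟩
  · intro v hv
    have := h.le v
    grind
  · intro u hu v hv huv
    have h3 := fun hu => h.meet u hu v
    have h4 := h.left u
    have h5 := h.right v
    have h6 := hadj u
    have h7 := fun hv => hadj v hv u
    have := huv.symm
    simp only [Finset.mem_union] at *
    grind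
  · intro b S hS
    refine h.card b S fun v hv => ?_
    have := hS v hv
    grind
  · intro x hx
    simp [hx, h.left x hx]
  · intro x hx
    simp [hx, h.right x hx]
  · intro y hy
    have := h.below y
    grind

theorem forall_mem_or_forall_mem_of_isChain {A B : V → Prop} (hAB : ∀ a b, A a → B b → ¬ G.Adj a b)
    (P : List V) (hP : P.IsChain G.Adj) (h : ∀ v ∈ P, A v ∨ B v) :
    (∀ v ∈ P, A v) ∨ ∀ v ∈ P, B v := by
  induction P with
  | nil => simp
  | cons x P ih =>
    rcases P with _ | ⟨y, P⟩
    · simpa using h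
    · rw [List.isChain_cons_cons] at hP
      have hx := h x (by simp)
      have := hAB x y
      have := hAB y x
      have := hP.1.symm
      rcases ih hP.2 fun v hv => h v (List.mem_cons_of_mem _ hv) with h' | h'
      · have := h' y (by simp)
        left
        simp only [List.forall_mem_cons (p := A) (a := x)]
        grind
      · have := h' y (by simp)
        right
        simp only [List.forall_mem_cons (p := B) (a := x)]
        grind

/-- A path of order at least `2 ^ M - 1` below the root of a tree decomposition meets the union of
the bags along some branch in at least `M` vertices. -/
theorem TreeDec.exists_branchRep [DecidableEq V] {K : ℕ} {X Y : Finset V} (h : G.TreeDec K X Y) :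
    ∀ (M : ℕ) (P : List V), P.IsChain G.Adj → P.Nodup → (∀ v ∈ P, v ∈ Y) → 2 ^ M ≤ P.length + 1 →
      ∃ l r, G.BranchRep K X Y l r ∧ M ≤ P.countP (fun v => l v < r v) := by
  induction h with
  | leaf X hX =>
    intro M P _ _ hPY hM
    obtain rfl : P = [] := List.eq_nil_iff_forall_not_mem.2 fun v hv => by simpa using hPY v hv
    obtain rfl : M = 0 := by
      by_contra h0
      have := Nat.one_lt_two_pow h0
      simp at hM
      omega
    refine ⟨fun _ => 0, fun _ => 1, ⟨?_, ?_, ?_, ?_, ?_, ?_⟩, Nat.zero_le _⟩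
    all_goals try simp
    intro b S hS
    exact (Finset.card_le_card fun v hv => (hS v hv).1).trans hX
  | introduce X B Y h hXB hB hBY hadj ih =>
    intro M P hP hnd hPY hM
    obtain ⟨l, r, hrep, hc⟩ := ih M P hP hnd hPY hM
    refine ⟨_, _, hrep.introduce hXB hB hBY hadj, hc.trans (List.countP_mono_left fun v hv => ?_)⟩
    have : v ∉ B := fun h => Finset.disjoint_left.1 hBY h (hPY v hv)
    simp [this]
  | forget B X Y h hXB ih =>
    intro M P hP hnd hPY hM
    obtain ⟨Q, hQP, hQB, hcount⟩ := P.exists_infix_forall_not (fun _ => true) (fun v => v ∈ B \ X)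
    set c := P.countP (fun v => v ∈ B \ X) with hc
    have hQY : ∀ v ∈ Q, v ∈ Y := fun v hv => by
      have h1 := hPY v (hQP.subset hv)
      have h2 := hQB v hv
      simp only [decide_eq_false_iff_not] at h2
      exact (Finset.mem_union.1 h1).resolve_right h2
    -- The `c` deletions leave at most `c + 1 ≤ 2 ^ c` blocks, so the exponent drops by at most `c`;
    -- the deleted vertices lie on the branch and make up for it.
    have hQlen : 2 ^ (M - c) ≤ Q.length + 1 := by
      rcases le_total M c with hMc | hMc
      · simp [Nat.sub_eq_zero_of_le hMc]
      · have h1 : c + 1 ≤ 2 ^ c := Nat.lt_two_pow_self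
        simp only [List.countP_true] at hcount
        have h2 : 2 ^ c * 2 ^ (M - c) ≤ 2 ^ c * (Q.length + 1) := by
          rw [← pow_add, Nat.add_sub_cancel' hMc]
          exact hM.trans (hcount.trans (Nat.mul_le_mul_right _ h1))
        exact Nat.le_of_mul_le_mul_left h2 (by positivity)
    obtain ⟨l, r, hrep, hl⟩ := ih (M - c) Q (hP.infix hQP) (hnd.sublist hQP.sublist) hQY hQlen
    refine ⟨_, _, hrep.forget hXB h.card_le h.disjoint, ?_⟩
    have hYX : ∀ v ∈ Y ∪ B \ X, v ∉ X := fun v hv hvX =>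
      Finset.disjoint_left.1 (TreeDec.forget B X Y h hXB).disjoint hvX hv
    set w : V → Bool := fun v => (if v ∈ X then 0 else l v + 1) < r v + 1 with hw
    have h1 : P.countP w = _ := List.countP_eq_countP_filter_add P w (fun v => v ∈ B \ X)
    have h2 : (P.filter (fun v => v ∈ B \ X)).countP w = c := by
      rw [hc, List.countP_eq_length_filter (p := fun v => decide (v ∈ B \ X)), List.countP_eq_length]
      intro v hv
      have hvB : v ∈ B \ X := by simpa using (List.mem_filter.1 hv).2
      have hvX := (Finset.mem_sdiff.1 hvB).2
      have h3 := hrep.left v (Finset.mem_sdiff.1 hvB).1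
      have h4 := hrep.right v (Finset.mem_sdiff.1 hvB).1
      simp only [hw, hvX, if_false, decide_eq_true_eq]
      omega
    have h3 : Q.countP (fun v => l v < r v) ≤ (P.filter (fun v => !decide (v ∈ B \ X))).countP w := by
      rw [List.countP_filter]
      refine (List.countP_mono_left fun v hv h => ?_).trans hQP.sublist.countP_le
      have h4 := hYX v (hPY v (hQP.subset hv))
      have h5 := hQB v hv
      simp only [hw, h4, if_false, h5]
      simpa using h
    omega
  | join X Y₁ Y₂ h₁ h₂ hadj ih₁ ih₂ =>
    intro M P hP hnd hPY hM
    rcases forall_mem_or_forall_mem_of_isChain (A := (· ∈ Y₁)) (B := (· ∈ Y₂))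
      (fun a b ha hb => hadj a ha b hb) P hP (fun v hv => Finset.mem_union.1 (hPY v hv)) with hA | hA
    · obtain ⟨l, r, hrep, hc⟩ := ih₁ M P hP hnd hA hM
      refine ⟨_, _, hrep.join h₂.disjoint hadj, hc.trans (List.countP_mono_left fun v hv => ?_)⟩
      simp [hA v hv]
    · obtain ⟨l, r, hrep, hc⟩ := ih₂ M P hP hnd hA hM
      rw [Finset.union_comm]
      refine ⟨_, _, hrep.join h₁.disjoint fun y hy z hz hyz => hadj z hz y hy hyz.symm,
        hc.trans (List.countP_mono_left fun v hv => ?_)⟩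
      simp [hA v hv]

/-- A graph of treewidth less than `K` with a path of order at least `2 ^ (m ^ K)` has an induced path
of order at least `m`. -/
theorem TreeDec.exists_pathGraph_isIndContained [DecidableEq V] {K : ℕ} {X Y : Finset V}
    (h : G.TreeDec K X Y) {m : ℕ} (hm : 1 ≤ m) {P : List V} (hP : P.IsChain G.Adj) (hnd : P.Nodup)
    (hPY : ∀ v ∈ P, v ∈ Y) (hlen : 2 ^ m ^ K ≤ P.length) :
    ∃ m', m ≤ m' ∧ (pathGraph m').IsIndContained G := by
  obtain ⟨l, r, hrep, hc⟩ := h.exists_branchRep (m ^ K) P hP hnd hPY (by omega)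
  have hmem : ∀ v ∈ P, v ∈ X ∪ Y := fun v hv => Finset.mem_union_right _ (hPY v hv)
  exact exists_pathGraph_isIndContained_of_intervals l r hm K P hP hnd
    (fun v hv => hrep.le v (hmem v hv)) (fun u hu v hv => hrep.meet u (hmem u hu) v (hmem v hv))
    (fun b S hS => hrep.card b S fun v hv => ⟨hmem v (hS v hv).1, (hS v hv).2⟩) hc

/-! ### From clique-width expressions to tree decompositions -/

/-- Vertices of `Y` with the same label have the same neighbours outside `Y`. -/
def Homogeneous (G : SimpleGraph V) {α : Type*} (Y : Finset V) (lab : V → α) : Prop :=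
  ∀ w, w ∉ Y → ∀ u ∈ Y, ∀ v ∈ Y, lab u = lab v → G.Adj u w → G.Adj v w

open scoped Classical in
/-- The vertices of `Y` in label classes of size less than `s`, and the outside neighbours of the
label classes of size at least `s`. -/
noncomputable def labelBag [Fintype V] (G : SimpleGraph V) {α : Type*} (s : ℕ) (Y : Finset V)
    (lab : V → α) : Finset V :=
  Finset.univ.filter fun v =>
    (v ∈ Y ∧ (Y.filter fun u => lab u = lab v).card < s) ∨
      (v ∉ Y ∧ ∃ u ∈ Y, s ≤ (Y.filter fun x => lab x = lab u).card ∧ G.Adj u v)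

open scoped Classical

section

variable [Fintype V] {α : Type*} {s : ℕ} {Y : Finset V} {lab : V → α}

theorem mem_labelBag_of_mem {v : V} (hv : v ∈ Y) :
    v ∈ G.labelBag s Y lab ↔ (Y.filter fun u => lab u = lab v).card < s := by
  simp [labelBag, hv]

theorem mem_labelBag_of_notMem {v : V} (hv : v ∉ Y) :
    v ∈ G.labelBag s Y lab ↔ ∃ u ∈ Y, s ≤ (Y.filter fun x => lab x = lab u).card ∧ G.Adj u v := by
  simp [labelBag, hv]

theorem subset_labelBag_of_card_lt (hY : Y.card < s) : Y ⊆ G.labelBag s Y lab := fun _ hv =>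
  (mem_labelBag_of_mem hv).2 ((Finset.card_filter_le _ _).trans_lt hY)

/-- Each label contributes at most `s - 1` vertices: a small class contributes itself, and a large
one is complete to its outside neighbours by homogeneity, so `s` of them would form a `K_{s,s}`. -/
theorem card_labelBag_le [Fintype α] (hY : G.Homogeneous Y lab)
    (hfree : ∀ A B : Finset V, s ≤ A.card → s ≤ B.card → ¬ ∀ a ∈ A, ∀ b ∈ B, G.Adj a b) :
    (G.labelBag s Y lab).card ≤ Fintype.card α * (s - 1) := by
  set C : α → Finset V := fun i => Y.filter fun u => lab u = i with hC
  set Z : α → Finset V := fun i => if (C i).card < s then C i else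
    Finset.univ.filter fun w => w ∉ Y ∧ ∃ u ∈ C i, G.Adj u w with hZ
  have hsub : G.labelBag s Y lab ⊆ Finset.univ.biUnion Z := by
    intro v hv
    simp only [Finset.mem_biUnion, Finset.mem_univ, true_and]
    by_cases hvY : v ∈ Y
    · rw [mem_labelBag_of_mem hvY] at hv
      exact ⟨lab v, by simp [hZ, hC, hv, hvY]⟩
    · rw [mem_labelBag_of_notMem hvY] at hv
      obtain ⟨u, hu, hus, huv⟩ := hv
      refine ⟨lab u, ?_⟩
      simp only [hZ, hC, if_neg (not_lt.2 hus), Finset.mem_filter, Finset.mem_univ, true_and]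
      exact ⟨hvY, u, ⟨hu, rfl⟩, huv⟩
  refine (Finset.card_le_card hsub).trans (Finset.card_biUnion_le_card_mul _ _ _ fun i _ => ?_)
  by_cases hi : (C i).card < s
  · simp only [hZ, if_pos hi]
    omega
  · simp only [hZ, if_neg hi]
    by_contra! hlt
    refine hfree (C i) _ (not_lt.1 hi) (Nat.le_of_pred_lt hlt) fun a ha b hb => ?_
    simp only [Finset.mem_filter, Finset.mem_univ, true_and, hC] at ha hb
    obtain ⟨hbY, u, ⟨hu, hui⟩, hub⟩ := hb
    exact hY b hbY u hu a ha.1 (hui.trans ha.2.symm) hub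

theorem mem_labelBag_of_adj {v w : V} (hv : v ∈ Y) (hvB : v ∉ G.labelBag s Y lab) (hw : w ∉ Y)
    (hvw : G.Adj v w) : w ∈ G.labelBag s Y lab := by
  rw [mem_labelBag_of_mem hv, not_lt] at hvB
  exact (mem_labelBag_of_notMem hw).2 ⟨v, hv, hvB, hvw⟩

/-- Coarsening the partition into label classes. -/
theorem treeDec_labelBag_of_coarsen {β : Type*} {lab' : V → β} {K : ℕ}
    (h : G.TreeDec K (G.labelBag s Y lab) (Y \ G.labelBag s Y lab))
    (hcoarse : ∀ u ∈ Y, ∀ v ∈ Y, lab u = lab v → lab' u = lab' v)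
    (hK : (G.labelBag s Y lab).card + (G.labelBag s Y lab').card ≤ K) :
    G.TreeDec K (G.labelBag s Y lab') (Y \ G.labelBag s Y lab') := by
  have hcard : ∀ v ∈ Y, (Y.filter fun u => lab u = lab v).card ≤
      (Y.filter fun u => lab' u = lab' v).card := fun v hv =>
    Finset.card_le_card fun u hu => by
      rw [Finset.mem_filter] at *
      exact ⟨hu.1, hcoarse u hu.1 v hv hu.2⟩
  -- Coarsening enlarges classes, so the bag can only lose vertices inside `Y` and only gain them
  -- outside.
  have hin : ∀ v ∈ Y, v ∈ G.labelBag s Y lab' → v ∈ G.labelBag s Y lab := fun v hv hvB => by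
    rw [mem_labelBag_of_mem hv] at *
    exact (hcard v hv).trans_lt hvB
  have hout : ∀ v, v ∉ Y → v ∈ G.labelBag s Y lab → v ∈ G.labelBag s Y lab' := fun v hv hvB => by
    rw [mem_labelBag_of_notMem hv] at *
    obtain ⟨u, hu, hus, huv⟩ := hvB
    exact ⟨u, hu, hus.trans (hcard u hu), huv⟩
  set X := G.labelBag s Y lab with hX
  set X' := G.labelBag s Y lab' with hX'
  have h1 : G.TreeDec K (X ∪ X') (Y \ X) := by
    refine TreeDec.introduce X _ _ h Finset.subset_union_left ((Finset.card_union_le _ _).trans hK)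
      ?_ ?_
    · rw [Finset.disjoint_left]
      intro v hv hvY
      rw [Finset.mem_sdiff] at hvY
      exact hvY.2 ((Finset.mem_union.1 hv).elim id (hin v hvY.1))
    · intro y hy b hb hbX hyb
      rw [Finset.mem_sdiff] at hy
      have hbX' := (Finset.mem_union.1 hb).resolve_left hbX
      exact hbX (mem_labelBag_of_adj hy.1 hy.2 (fun hbY => hbX (hin b hbY hbX')) hyb)
  have h2 := TreeDec.forget _ X' _ h1 Finset.subset_union_right
  convert h2 using 1
  ext v
  have := hin v
  have := hout v
  simp only [Finset.mem_union, Finset.mem_sdiff]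
  tauto

/-- Both decompositions are extended to the union of the three bags, joined there, and the surplus
is forgotten. -/
theorem treeDec_labelBag_union {Z : Finset V} {K : ℕ} (hYZ : Disjoint Y Z)
    (hY : G.TreeDec K (G.labelBag s Y lab) (Y \ G.labelBag s Y lab))
    (hZ : G.TreeDec K (G.labelBag s Z lab) (Z \ G.labelBag s Z lab))
    (homY : G.Homogeneous Y lab) (homZ : G.Homogeneous Z lab)
    (hfree : ∀ A B : Finset V, s ≤ A.card → s ≤ B.card → ¬ ∀ a ∈ A, ∀ b ∈ B, G.Adj a b)
    (hK : (G.labelBag s (Y ∪ Z) lab).card + (G.labelBag s Y lab).card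
      + (G.labelBag s Z lab).card ≤ K) :
    G.TreeDec K (G.labelBag s (Y ∪ Z) lab) ((Y ∪ Z) \ G.labelBag s (Y ∪ Z) lab) := by
  have hnY : ∀ v ∈ Z, v ∉ Y := fun v hv hvY => Finset.disjoint_left.1 hYZ hvY hv
  have hnZ : ∀ v ∈ Y, v ∉ Z := fun v hv hvY => Finset.disjoint_left.1 hYZ hv hvY
  -- If neither end were in its own bag, both classes would be large and, by homogeneity on both
  -- sides, complete to each other.
  have hcross : ∀ y ∈ Y, ∀ z ∈ Z, G.Adj y z → y ∉ G.labelBag s Y lab →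
      z ∈ G.labelBag s Z lab := by
    intro y hy z hz hyz hyB
    by_contra hzB
    rw [mem_labelBag_of_mem hy, not_lt] at hyB
    rw [mem_labelBag_of_mem hz, not_lt] at hzB
    refine hfree _ _ hyB hzB fun a ha b hb => ?_
    rw [Finset.mem_filter] at ha hb
    have h1 := homY z (hnY z hz) y hy a ha.1 ha.2.symm hyz
    exact (homZ a (hnZ a ha.1) z hz b hb.1 hb.2.symm h1.symm).symm
  have hcardY : ∀ v, (Y.filter fun u => lab u = lab v).card ≤
      ((Y ∪ Z).filter fun u => lab u = lab v).card := fun v =>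
    Finset.card_le_card (Finset.filter_subset_filter _ Finset.subset_union_left)
  have hcardZ : ∀ v, (Z.filter fun u => lab u = lab v).card ≤
      ((Y ∪ Z).filter fun u => lab u = lab v).card := fun v =>
    Finset.card_le_card (Finset.filter_subset_filter _ Finset.subset_union_right)
  have hinY : ∀ v ∈ Y, v ∈ G.labelBag s (Y ∪ Z) lab → v ∈ G.labelBag s Y lab := fun v hv h => by
    rw [mem_labelBag_of_mem hv]
    rw [mem_labelBag_of_mem (Finset.mem_union_left _ hv)] at h
    exact (hcardY v).trans_lt h
  have hinZ : ∀ v ∈ Z, v ∈ G.labelBag s (Y ∪ Z) lab → v ∈ G.labelBag s Z lab := fun v hv h => by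
    rw [mem_labelBag_of_mem hv]
    rw [mem_labelBag_of_mem (Finset.mem_union_right _ hv)] at h
    exact (hcardZ v).trans_lt h
  have houtY : ∀ v, v ∉ Y → v ∉ Z → v ∈ G.labelBag s Y lab → v ∈ G.labelBag s (Y ∪ Z) lab := by
    intro v hvY hvZ h
    rw [mem_labelBag_of_notMem hvY] at h
    rw [mem_labelBag_of_notMem (by simp [hvY, hvZ])]
    obtain ⟨u, hu, hus, huv⟩ := h
    exact ⟨u, Finset.mem_union_left _ hu, hus.trans (hcardY u), huv⟩
  have houtZ : ∀ v, v ∉ Y → v ∉ Z → v ∈ G.labelBag s Z lab → v ∈ G.labelBag s (Y ∪ Z) lab := by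
    intro v hvY hvZ h
    rw [mem_labelBag_of_notMem hvZ] at h
    rw [mem_labelBag_of_notMem (by simp [hvY, hvZ])]
    obtain ⟨u, hu, hus, huv⟩ := h
    exact ⟨u, Finset.mem_union_right _ hu, hus.trans (hcardZ u), huv⟩
  have hZY : ∀ v ∈ Y, v ∈ G.labelBag s Z lab → v ∈ G.labelBag s Y lab := fun v hv h => by
    by_contra hvB
    rw [mem_labelBag_of_notMem (hnZ v hv)] at h
    obtain ⟨u, hu, hus, huv⟩ := h
    exact not_lt.2 hus ((mem_labelBag_of_mem hu).1 (hcross v hv u hu huv.symm hvB))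
  have hYZ' : ∀ v ∈ Z, v ∈ G.labelBag s Y lab → v ∈ G.labelBag s Z lab := fun v hv h => by
    rw [mem_labelBag_of_notMem (hnY v hv)] at h
    obtain ⟨u, hu, hus, huv⟩ := h
    refine hcross u hu v hv huv fun h => ?_
    exact not_lt.2 hus ((mem_labelBag_of_mem hu).1 h)
  have hadjY : ∀ v ∈ Y, v ∉ G.labelBag s Y lab → ∀ w, w ∉ Y → G.Adj v w →
      w ∈ G.labelBag s Y lab := fun v hv hvB w hw hvw => mem_labelBag_of_adj hv hvB hw hvw
  have hadjZ : ∀ v ∈ Z, v ∉ G.labelBag s Z lab → ∀ w, w ∉ Z → G.Adj v w →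
      w ∈ G.labelBag s Z lab := fun v hv hvB w hw hvw => mem_labelBag_of_adj hv hvB hw hvw
  set X := G.labelBag s (Y ∪ Z) lab
  set XY := G.labelBag s Y lab
  set XZ := G.labelBag s Z lab
  set B := X ∪ XY ∪ XZ with hB
  have hBK : B.card ≤ K :=
    ((Finset.card_union_le _ _).trans (Nat.add_le_add_right (Finset.card_union_le _ _) _)).trans hK
  have hBY : ∀ v ∈ Y, v ∈ B → v ∈ XY := by
    intro v hv hvB
    have := hinY v hv
    have := hZY v hv
    simp only [hB, Finset.mem_union] at hvB
    rcases hvB with (h | h) | h <;> simp_all only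
  have hBZ : ∀ v ∈ Z, v ∈ B → v ∈ XZ := by
    intro v hv hvB
    have := hinZ v hv
    have := hYZ' v hv
    simp only [hB, Finset.mem_union] at hvB
    rcases hvB with (h | h) | h <;> simp_all only
  have h1 : G.TreeDec K B (Y \ XY) := by
    refine TreeDec.introduce XY _ _ hY (fun v hv => by simp [hB, hv]) hBK ?_ ?_
    · rw [Finset.disjoint_left]
      intro v hv hvY
      rw [Finset.mem_sdiff] at hvY
      exact hvY.2 (hBY v hvY.1 hv)
    · intro y hy b hb hbX hyb
      rw [Finset.mem_sdiff] at hy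
      exact hbX (hadjY y hy.1 hy.2 b (fun hbY => hbX (hBY b hbY hb)) hyb)
  have h2 : G.TreeDec K B (Z \ XZ) := by
    refine TreeDec.introduce XZ _ _ hZ (fun v hv => by simp [hB, hv]) hBK ?_ ?_
    · rw [Finset.disjoint_left]
      intro v hv hvY
      rw [Finset.mem_sdiff] at hvY
      exact hvY.2 (hBZ v hvY.1 hv)
    · intro y hy b hb hbX hyb
      rw [Finset.mem_sdiff] at hy
      exact hbX (hadjZ y hy.1 hy.2 b (fun hbY => hbX (hBZ b hbY hb)) hyb)
  have h3 := TreeDec.join B _ _ h1 h2 fun y hy z hz hyz => by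
    rw [Finset.mem_sdiff] at hy hz
    exact hz.2 (hcross y hy.1 z hz.1 hyz hy.2)
  have h4 := TreeDec.forget B X _ h3 (fun v hv => by simp [hB, hv])
  convert h4 using 1
  ext v
  have h5 := hinY v
  have h6 := hinZ v
  have h7 := houtY v
  have h8 := houtZ v
  clear * - h5 h6 h7 h8
  simp only [Finset.mem_union, Finset.mem_sdiff]
  grind

end

/-- A labelled graph with a clique-width expression, sitting in a graph `G` without `K_{s,s}` in such
a way that its adjacency to the rest of `G` and the edges of `G` added to it are determined by the
labels. -/
theorem treeDec_labelBag_of_cwExpr [Fintype V] {k s K : ℕ} (hs : 2 ≤ s)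
    (hK : 3 * (k * (s - 1)) ≤ K)
    (hfree : ∀ A B : Finset V, s ≤ A.card → s ≤ B.card → ¬ ∀ a ∈ A, ∀ b ∈ B, G.Adj a b)
    (e : CWExpr k) :
    ∀ (φ : e.Vert → V) (R : Fin k → Fin k → Prop) (lab : V → Fin k) (Y : Finset V),
      Function.Injective φ → (∀ x, lab (φ x) = e.label x) →
      (∀ x y, x ≠ y → (G.Adj (φ x) (φ y) ↔ e.graph.Adj x y ∨ R (e.label x) (e.label y))) →
      (∀ v, v ∈ Y ↔ ∃ x, φ x = v) → G.Homogeneous Y lab →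
      G.TreeDec K (G.labelBag s Y lab) (Y \ G.labelBag s Y lab) := by
  have hcard : ∀ (Y : Finset V) (lab : V → Fin k), G.Homogeneous Y lab →
      (G.labelBag s Y lab).card ≤ k * (s - 1) := fun Y lab hY => by
    simpa using card_labelBag_le hY hfree
  induction e with
  | vertex i =>
    intro φ R lab Y _ _ _ hY hhom
    have hYs : Y = {φ ()} := by
      ext v
      rw [hY, Finset.mem_singleton]
      exact ⟨fun ⟨x, hx⟩ => hx.symm, fun h => ⟨(), h.symm⟩⟩
    have hempty : Y \ G.labelBag s Y lab = ∅ := by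
      rw [Finset.sdiff_eq_empty_iff_subset]
      refine subset_labelBag_of_card_lt ?_
      rw [hYs, Finset.card_singleton]
      omega
    rw [hempty]
    exact TreeDec.leaf _ ((hcard Y lab hhom).trans (by omega))
  | union a b iha ihb =>
    intro φ R lab Y hφ hlab hadj hY hhom
    set φa : a.Vert → V := fun x => φ (Sum.inl x : a.Vert ⊕ b.Vert) with hφa
    set φb : b.Vert → V := fun x => φ (Sum.inr x : a.Vert ⊕ b.Vert) with hφb
    have hab : ∀ x y, φa x ≠ φb y := fun x y h => Sum.inl_ne_inr (hφ h)
    have hca : ∀ x y, G.Adj (φa x) (φb y) ↔ R (a.label x) (b.label y) := fun x y => by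
      refine (hadj _ _ (fun h => Sum.inl_ne_inr h)).trans ?_
      exact or_iff_right (by simp [CWExpr.graph])
    have hcb : ∀ x y, G.Adj (φb y) (φa x) ↔ R (b.label y) (a.label x) := fun x y => by
      refine (hadj _ _ (fun h => Sum.inr_ne_inl h)).trans ?_
      exact or_iff_right (by simp [CWExpr.graph])
    set A : Finset V := Finset.univ.filter fun v => ∃ x, φa x = v with hA
    set B : Finset V := Finset.univ.filter fun v => ∃ x, φb x = v with hB
    have hmA : ∀ v, v ∈ A ↔ ∃ x, φa x = v := by simp [hA]
    have hmB : ∀ v, v ∈ B ↔ ∃ x, φb x = v := by simp [hB]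
    have hYAB : Y = A ∪ B := by
      ext v
      rw [hY, Finset.mem_union, hmA, hmB]
      constructor
      · rintro ⟨x | x, hx⟩
        · exact Or.inl ⟨x, hx⟩
        · exact Or.inr ⟨x, hx⟩
      · rintro (⟨x, hx⟩ | ⟨x, hx⟩)
        · exact ⟨_, hx⟩
        · exact ⟨_, hx⟩
    have hdis : Disjoint A B := by
      rw [Finset.disjoint_left]
      intro v hv hv'
      obtain ⟨x, rfl⟩ := (hmA v).1 hv
      obtain ⟨y, hy⟩ := (hmB _).1 hv'
      exact hab x y hy.symm
    have hla : ∀ x, lab (φa x) = a.label x := fun x => hlab _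
    have hlb : ∀ x, lab (φb x) = b.label x := fun x => hlab _
    have homA : G.Homogeneous A lab := by
      intro w hw u hu v hv huv huw
      by_cases hwB : w ∈ B
      · obtain ⟨y, rfl⟩ := (hmB w).1 hwB
        obtain ⟨x, rfl⟩ := (hmA u).1 hu
        obtain ⟨x', rfl⟩ := (hmA v).1 hv
        rw [hla, hla] at huv
        rwa [hca, ← huv, ← hca]
      · exact hhom w (by simp [hYAB, hw, hwB]) u (by simp [hYAB, hu]) v (by simp [hYAB, hv]) huv huw
    have homB : G.Homogeneous B lab := by
      intro w hw u hu v hv huv huw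
      by_cases hwA : w ∈ A
      · obtain ⟨y, rfl⟩ := (hmA w).1 hwA
        obtain ⟨x, rfl⟩ := (hmB u).1 hu
        obtain ⟨x', rfl⟩ := (hmB v).1 hv
        rw [hlb, hlb] at huv
        rwa [hcb, ← huv, ← hcb]
      · exact hhom w (by simp [hYAB, hw, hwA]) u (by simp [hYAB, hu]) v (by simp [hYAB, hv]) huv huw
    have hta := iha φa R lab A (fun x y h => Sum.inl_injective (hφ h)) hla
      (fun x y hxy => (hadj _ _ fun h => hxy (Sum.inl_injective h)).trans
        (by simp [CWExpr.graph, CWExpr.label])) hmA homA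
    have htb := ihb φb R lab B (fun x y h => Sum.inr_injective (hφ h)) hlb
      (fun x y hxy => (hadj _ _ fun h => hxy (Sum.inr_injective h)).trans
        (by simp [CWExpr.graph, CWExpr.label])) hmB homB
    have hcY := hcard Y lab hhom
    have hcA := hcard A lab homA
    have hcB := hcard B lab homB
    rw [hYAB] at hcY ⊢
    exact treeDec_labelBag_union hdis hta htb homA homB hfree (by omega)
  -- Bags are computed in the final graph `G`, so a join changes nothing: its edges are absorbed
  -- into `R`.
  | join i j hij a iha =>
    intro φ R lab Y hφ hlab hadj hY hhom
    refine iha φ (fun p q => (p = i ∧ q = j) ∨ (q = i ∧ p = j) ∨ R p q) lab Y hφ hlab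
      (fun x y hxy => (hadj x y hxy).trans ?_) hY hhom
    change (a.graph.Adj x y ∨ (x ≠ y ∧ ((a.label x = i ∧ a.label y = j) ∨
      (a.label y = i ∧ a.label x = j)))) ∨ R (a.label x) (a.label y) ↔ _
    change x ≠ y at hxy
    tauto
  | relabel i j a iha =>
    intro φ R lab Y hφ hlab hadj hY hhom
    set f : Fin k → Fin k := fun p => if p = i then j else p with hf
    -- The values of `lab₀` outside `Y` are irrelevant; `lab` is only a default.
    set lab₀ : V → Fin k := Function.extend φ a.label lab with hlab₀
    have hl₀ : ∀ x, lab₀ (φ x) = a.label x := fun x => hφ.extend_apply a.label lab x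
    have hl : ∀ x, lab (φ x) = f (a.label x) := hlab
    have hcoarse : ∀ u ∈ Y, ∀ v ∈ Y, lab₀ u = lab₀ v → lab u = lab v := by
      intro u hu v hv huv
      obtain ⟨x, rfl⟩ := (hY u).1 hu
      obtain ⟨y, rfl⟩ := (hY v).1 hv
      rw [hl, hl, ← hl₀, huv, hl₀]
    have hhom₀ : G.Homogeneous Y lab₀ := fun w hw u hu v hv huv =>
      hhom w hw u hu v hv (hcoarse u hu v hv huv)
    have h := iha φ (fun p q => R (f p) (f q)) lab₀ Y hφ hl₀ hadj hY hhom₀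
    have h1 := hcard Y lab hhom
    have h2 := hcard Y lab₀ hhom₀
    exact treeDec_labelBag_of_coarsen h hcoarse (by omega)

/-- A graph of clique-width at most `k` without `K_{s,s}` has treewidth less than `3 k (s - 1)`. -/
theorem HasCliqueWidthLE.treeDec [Fintype V] [Nonempty V] {k s K : ℕ} (h : G.HasCliqueWidthLE k)
    (hs : 2 ≤ s) (hK : 3 * (k * (s - 1)) ≤ K)
    (hfree : ∀ A B : Finset V, s ≤ A.card → s ≤ B.card → ¬ ∀ a ∈ A, ∀ b ∈ B, G.Adj a b) :
    G.TreeDec K ∅ Finset.univ := by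
  obtain h | ⟨e, ⟨φ⟩⟩ := h
  · exact absurd h (not_isEmpty_of_nonempty V)
  have := TreeDec.forget _ ∅ _ (treeDec_labelBag_of_cwExpr hs hK hfree e φ (fun _ _ => False)
    (fun v => e.label (φ.symm v)) Finset.univ φ.injective (by simp) (fun x y _ => by simpa using φ.map_adj_iff)
    (fun v => by simpa using ⟨φ.symm v, by simp⟩) (fun w hw => absurd (Finset.mem_univ w) hw))
    (Finset.empty_subset _)
  convert this using 1
  ext v
  simp

/-! ### Translation of the hypotheses and the final bound -/

theorem Free.not_forall_adj {s : ℕ} (h : (completeBipartiteGraph (Fin s) (Fin s)).Free G)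
    (A B : Finset V) (hA : s ≤ A.card) (hB : s ≤ B.card) : ¬ ∀ a ∈ A, ∀ b ∈ B, G.Adj a b := by
  intro hAB
  obtain ⟨f⟩ : Nonempty (Fin s ↪ A) := Function.Embedding.nonempty_of_card_le (by simpa using hA)
  obtain ⟨g⟩ : Nonempty (Fin s ↪ B) := Function.Embedding.nonempty_of_card_le (by simpa using hB)
  refine h ⟨⟨⟨Sum.elim (fun i => (f i : V)) (fun i => (g i : V)), ?_⟩, ?_⟩⟩
  · rintro (i | i) (j | j) hij
    · simp at hij
    · exact hAB _ (f i).2 _ (g j).2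
    · exact (hAB _ (f j).2 _ (g i).2).symm
    · simp at hij
  · rintro (i | i) (j | j) hij
    · exact congrArg _ (f.injective (Subtype.ext hij))
    · exact absurd hij (hAB _ (f i).2 _ (g j).2).ne
    · exact absurd hij (hAB _ (f j).2 _ (g i).2).ne'
    · exact congrArg _ (g.injective (Subtype.ext hij))

theorem exists_list_of_pathGraph_isContained {n : ℕ} (h : (pathGraph n).IsContained G) :
    ∃ P : List V, P.IsChain G.Adj ∧ P.Nodup ∧ P.length = n := by
  obtain ⟨f⟩ := h
  refine ⟨List.ofFn f, ?_, List.nodup_ofFn.2 f.injective, List.length_ofFn⟩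
  rw [List.isChain_iff_getElem]
  intro i hi
  rw [List.length_ofFn] at hi
  simp only [List.getElem_ofFn]
  exact f.toHom.map_adj (pathGraph_adj.2 (Or.inl rfl))

theorem exists_hasCliqueWidthLE_of_cliqueWidth_lt {k : ℕ} (h : G.cliqueWidth < k) :
    ∃ k' < k, G.HasCliqueWidthLE k' := by
  simp only [cliqueWidth, iInf_lt_iff] at h
  obtain ⟨k', h', hk⟩ := h
  exact ⟨k', by exact_mod_cast hk, h'⟩

theorem HasCliqueWidthLE.pos [Nonempty V] {k : ℕ} (h : G.HasCliqueWidthLE k) : 1 ≤ k := by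
  obtain h | ⟨e, ⟨φ⟩⟩ := h
  · exact absurd h (not_isEmpty_of_nonempty V)
  · exact (e.label (φ.symm (Classical.arbitrary V))).pos

/-- The witness is the floor of the `K`-th root of the logarithm. That root is at least `1`, so
rounding loses less than a factor of `2`, and `1 / 4` is generous. -/
theorem exists_pow_le_and_rpow_le {n K : ℕ} (hn : 2 ≤ n) (hK : 1 ≤ K) :
    ∃ m : ℕ, 1 ≤ m ∧ 2 ^ m ^ K ≤ n ∧ 1 / 4 * Real.logb 2 n ^ (1 / (K : ℝ)) ≤ m := by
  have hn' : (2 : ℝ) ≤ n := by exact_mod_cast hn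
  have hlog : 1 ≤ Real.logb 2 n := by
    rw [Real.le_logb_iff_rpow_le (by norm_num) (by linarith)]
    simpa using hn'
  set x := Real.logb 2 n ^ (1 / (K : ℝ)) with hx
  have hx1 : 1 ≤ x := Real.one_le_rpow hlog (by positivity)
  have hxK : x ^ K = Real.logb 2 n := by
    rw [hx, one_div, Real.rpow_inv_natCast_pow (by linarith) (by omega)]
  refine ⟨⌊x⌋₊, Nat.one_le_floor_iff x |>.2 hx1, ?_, ?_⟩
  · have h1 : ((⌊x⌋₊ ^ K : ℕ) : ℝ) ≤ Real.logb 2 n := by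
      rw [← hxK, Nat.cast_pow]
      exact pow_le_pow_left₀ (Nat.cast_nonneg _) (Nat.floor_le (by linarith)) K
    rw [Real.le_logb_iff_rpow_le (by norm_num) (by linarith), Real.rpow_natCast] at h1
    exact_mod_cast h1
  · have h1 := Nat.lt_floor_add_one x
    have h2 : (1 : ℝ) ≤ ⌊x⌋₊ := by exact_mod_cast (Nat.one_le_floor_iff x).2 hx1
    linarith

end SimpleGraph

theorem corollary1p8 {V : Type*} [Finite V] (G : SimpleGraph V) (k s n : ℕ)
    (hk : 1 ≤ k) (hs : 1 ≤ s) (hn : 1 ≤ n)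
    (hfree : (completeBipartiteGraph (Fin s) (Fin s)).Free G)
    (hcw : G.cliqueWidth < (k : ℕ∞))
    (hpath : (SimpleGraph.pathGraph n).IsContained G) :
    ∃ m : ℕ, 1 ≤ m ∧ (SimpleGraph.pathGraph m).IsIndContained G ∧
      (1 / 4 : ℝ) * (Real.logb 2 (n : ℝ)) ^ (1 / (3 * ((k : ℝ) - 1) * ((s : ℝ) - 1))) ≤ (m : ℝ) := by
  classical
  have := Fintype.ofFinite V
  obtain ⟨f⟩ := id hpath
  have : Nonempty V := ⟨f ⟨0, hn⟩⟩
  -- For `n = 1` the logarithm is `0`, and any real power of `0` is at most `1`.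
  rcases hn.eq_or_lt with rfl | hn2
  · refine ⟨1, le_rfl, ⟨⟨⟨f, f.injective⟩, ?_⟩⟩, ?_⟩
    · intro i j
      simp [Subsingleton.elim i j]
    · rw [Nat.cast_one, Real.logb_one]
      have := Real.zero_rpow_le_one (1 / (3 * ((k : ℝ) - 1) * ((s : ℝ) - 1)))
      linarith
  -- An edge of the path is already a `K_{1,1}`.
  have hs2 : 2 ≤ s := by
    by_contra! hlt
    obtain rfl : s = 1 := by omega
    refine hfree.not_forall_adj {f ⟨0, hn⟩} {f ⟨1, hn2⟩} (by simp) (by simp) ?_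
    simp only [Finset.mem_singleton, forall_eq]
    exact f.toHom.map_adj (SimpleGraph.pathGraph_adj.2 (Or.inl rfl))
  obtain ⟨k', hk', hG⟩ := SimpleGraph.exists_hasCliqueWidthLE_of_cliqueWidth_lt hcw
  -- With `k' < k` this gives `2 ≤ k`, so the exponent is not degenerate.
  have hk'pos := hG.pos
  have hT := hG.treeDec (K := 3 * ((k - 1) * (s - 1))) hs2
    (Nat.mul_le_mul_left _ (Nat.mul_le_mul_right _ (by omega))) hfree.not_forall_adj
  obtain ⟨m, hm, hmn, hmx⟩ := SimpleGraph.exists_pow_le_and_rpow_le (K := 3 * ((k - 1) * (s - 1)))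
    hn2 (Nat.mul_pos (by norm_num) (Nat.mul_pos (by omega) (by omega)))
  obtain ⟨P, hP, hnd, hlen⟩ := SimpleGraph.exists_list_of_pathGraph_isContained hpath
  obtain ⟨m', hmm', hind⟩ := hT.exists_pathGraph_isIndContained hm hP hnd (by simp) (hlen ▸ hmn)
  refine ⟨m', hm.trans hmm', hind, ?_⟩
  have hcast : ((3 * ((k - 1) * (s - 1)) : ℕ) : ℝ) = 3 * ((k : ℝ) - 1) * ((s : ℝ) - 1) := by
    push_cast [Nat.cast_sub hk, Nat.cast_sub hs]
    ring
  rw [hcast] at hmx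
  exact hmx.trans (by exact_mod_cast hmm')
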